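/- **Setting.** Let $f:\mathcal X\times\mathcal Y\to\mathcal Z$ be a function, where Al receives $x\in\mathcal X$ and Bob receives $y\in\mathcal Y$. Its *deterministic communication complexity* is the least depth of a deterministic two-party protocol tree computing $f$: at each inner node one player announces one bit depending on his own input, and the leaf reached on $(x,y)$ is labelled $f(x,y)$. In a *quantum protocol* each player has private qubits and there is a message register; all qubits are initially in the state $|0\rangle$. The players alternately act, Al first: at his turn a player applies a unitary transformation, depending on his input, to his private qubits and the message register, and then hands the message register over to the other player. After the last message its receiver acts once more; at the end each player measures his private qubits in the computational basis and computes an answer from the outcome and his input. The *communication* is the total number of qubits sent. The protocol computes $f$ with *error* $\varepsilon$ if, for all $x,y$, both players give the answer $f(x,y)$ with probability at least $1-\varepsilon$. A player taking Al's place may own any finite number of private qubits (initially in the state $|0\rangle$) and apply, at Al's turns, any unitary transformations depending on $x$ to them and the message register. He is *honest* if, for all inputs $x,y$ and every round in which Al has to send a message, the density matrix of the message that he sends in his interaction with the prescribed Bob equals the density matrix of the message that Al sends in the prescribed protocol. Since the players are *nonpreemptive*, only the final state counts: let $\rho_A^{xy}$ be the reduced density matrix of his private qubits at the end of the interaction (a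 message received in the last round can be moved into the private qubits by his last action). Honest players in Bob's place, and their final states $\rho_B^{xy}$, are defined symmetrically. Let $\|M\|_{t}=\mathrm{Tr}\sqrt{M^\dagger M}$ be the trace norm. **Theorem.** There is a universal constant $C$ such that for every function $f:\mathcal X\times\mathcal Y\to\mathcal Z$ with (finite) deterministic communication complexity $c$ and every $\varepsilon>0$ there is a quantum protocol with communication at most $C\,c^2$ that computes $f$ with error at most $\varepsilon$ and has the following properties. * For every honest player in Al's place there are density matrices $\sigma_A(x,z)$ ($x\in\mathcal X$, $z\in\mathcal Z$), depending only on his own input and a function value, such that $\|\rho_A^{xy}-\sigma_A(x,f(x,y))\|_{t}\le\varepsilon$ for all $x\in\mathcal X,\ y\in\mathcal Y$. * For every honest player in Bob's place there are density matrices $\sigma_B(y,z)$ ($y\in\mathcal Y$, $z\in\mathcal Z$) such that $\|\rho_B^{xy}-\sigma_B(y,f(x,y))\|_{t}\le\varepsilon$ for all $x\in\mathcal X,\ y\in\mathcal Y$. -/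

import Mathlib

universe u v w

/-! ### Deterministic communication complexity -/

/-- A deterministic two-party protocol tree. At an inner node one of the players announces one bit
computed from his own input (and from the node, that is, from the bits announced so far); a leaf
carries the answer, which is thereby known to both players. -/
inductive DetTree (X : Type u) (Y : Type v) (Z : Type w) : Type (max u v w)
  | leaf (z : Z) : DetTree X Y Z
  | al (bit : X → Bool) (child : Bool → DetTree X Y Z) : DetTree X Y Z
  | bob (bit : Y → Bool) (child : Bool → DetTree X Y Z) : DetTree X Y Z

namespace DetTree

variable {X : Type u} {Y : Type v} {Z : Type w}

/-- The answer reached on inputs `x`, `y`. -/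
def eval : DetTree X Y Z → X → Y → Z
  | leaf z, _, _ => z
  | al bit child, x, y => (child (bit x)).eval x y
  | bob bit child, x, y => (child (bit y)).eval x y

/-- The number of bits exchanged in the worst case. -/
def depth : DetTree X Y Z → ℕ
  | leaf _ => 0
  | al _ child => max (child false).depth (child true).depth + 1
  | bob _ child => max (child false).depth (child true).depth + 1

end DetTree

/-- The deterministic communication complexity of `f`: the least depth of a protocol tree that
computes `f` (and `⊤` if there is none). -/
noncomputable def detCC {X : Type u} {Y : Type v} {Z : Type w} (f : X → Y → Z) : ℕ∞ :=
  ⨅ (t : DetTree X Y Z) (_ : ∀ x y, t.eval x y = f x y), (t.depth : ℕ∞)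

/-! ### Quantum protocols -/

/-- The computational basis of a register of `n` qubits. -/
abbrev QubitBasis (n : ℕ) : Type := Fin n → Bool

/-- The way in which one of the two players, with inputs from `I`, acts in a protocol whose
messages consist of `k` qubits: he owns `mem` private qubits, and when it is his turn at time `t`
he applies the unitary transformation `op t i`, depending on his input `i`, to his private qubits
together with the `k` qubits of the message that he just received.
Measurements and other quantum operations are covered through additional private qubits. -/
structure QPlayer (I : Type u) (k : ℕ) : Type u where
  mem : ℕ
  op : ℕ → I → Matrix.unitaryGroup (QubitBasis mem × QubitBasis k) ℂ

/-- A joint pure state of Al's `a` private qubits, the `k` message qubits, and Bob's `b` private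
qubits, given by its amplitudes. -/
abbrev JointState (a k b : ℕ) : Type := QubitBasis a × QubitBasis k × QubitBasis b → ℂ

namespace JointState

variable {a k b : ℕ}

/-- All qubits are in the basis state `0`. -/
def blank (a k b : ℕ) : JointState a k b := fun s =>
  if s = (fun _ => false, fun _ => false, fun _ => false) then 1 else 0

/-- A transformation of Al's private qubits and the message qubits. -/
noncomputable def applyAl (U : Matrix (QubitBasis a × QubitBasis k) (QubitBasis a × QubitBasis k) ℂ)
    (ψ : JointState a k b) : JointState a k b := fun s =>
  ∑ r : QubitBasis a × QubitBasis k, U (s.1, s.2.1) r * ψ (r.1, r.2, s.2.2)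

/-- A transformation of Bob's private qubits and the message qubits. -/
noncomputable def applyBob
    (U : Matrix (QubitBasis b × QubitBasis k) (QubitBasis b × QubitBasis k) ℂ)
    (ψ : JointState a k b) : JointState a k b := fun s =>
  ∑ r : QubitBasis b × QubitBasis k, U (s.2.2, s.2.1) r * ψ (s.1, r.2, r.1)

/-- The reduced density matrix of the message qubits. -/
noncomputable def msgDensity (ψ : JointState a k b) :
    Matrix (QubitBasis k) (QubitBasis k) ℂ :=
  Matrix.of fun m m' => ∑ i : QubitBasis a, ∑ j : QubitBasis b, ψ (i, m, j) * star (ψ (i, m', j))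

/-- The reduced density matrix of Al's private qubits. -/
noncomputable def alDensity (ψ : JointState a k b) :
    Matrix (QubitBasis a) (QubitBasis a) ℂ :=
  Matrix.of fun i i' => ∑ m : QubitBasis k, ∑ j : QubitBasis b, ψ (i, m, j) * star (ψ (i', m, j))

/-- The reduced density matrix of Bob's private qubits. -/
noncomputable def bobDensity (ψ : JointState a k b) :
    Matrix (QubitBasis b) (QubitBasis b) ℂ :=
  Matrix.of fun j j' => ∑ i : QubitBasis a, ∑ m : QubitBasis k, ψ (i, m, j) * star (ψ (i, m, j'))

end JointState

/-- The joint state after the first `t` actions, when the players `A` and `B` interact on inputs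
`x`, `y`. Initially all qubits are blank; Al acts at the even times and Bob at the odd times, and
after each action the message qubits are handed over to the other player. -/
noncomputable def jointRun {X : Type u} {Y : Type v} {k : ℕ} (A : QPlayer X k) (B : QPlayer Y k)
    (x : X) (y : Y) : ℕ → JointState A.mem k B.mem
  | 0 => JointState.blank A.mem k B.mem
  | t + 1 =>
    if Even t then JointState.applyAl (A.op t x).1 (jointRun A B x y t)
    else JointState.applyBob (B.op t y).1 (jointRun A B x y t)

/-- A two-party quantum protocol with `rounds` messages of `width` qubits each. The message with
number `t < rounds` is sent after the action at time `t`. After the last message its receiver acts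
once more, at time `rounds`. Then each player measures his private qubits in the computational
basis and computes his answer from the outcome and his input. -/
structure QProtocol (X : Type u) (Y : Type v) (Z : Type w) : Type (max u v w) where
  width : ℕ
  rounds : ℕ
  al : QPlayer X width
  bob : QPlayer Y width
  alOut : X → QubitBasis al.mem → Z
  bobOut : Y → QubitBasis bob.mem → Z

namespace QProtocol

variable {X : Type u} {Y : Type v} {Z : Type w} (P : QProtocol X Y Z)

/-- The number of qubits exchanged. -/
def cost : ℕ := P.rounds * P.width

open Classical in
/-- The probability that both players give the answer `f x y` on inputs `x`, `y`. -/
noncomputable def successProb (f : X → Y → Z) (x : X) (y : Y) : ℝ :=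
  ∑ s : QubitBasis P.al.mem × QubitBasis P.width × QubitBasis P.bob.mem,
    if P.alOut x s.1 = f x y ∧ P.bobOut y s.2.2 = f x y then
      ‖jointRun P.al P.bob x y (P.rounds + 1) s‖ ^ 2
    else 0

/-- The protocol computes `f` with error at most `ε` on every input. -/
def ComputesWithError (f : X → Y → Z) (ε : ℝ) : Prop :=
  ∀ x y, 1 - ε ≤ P.successProb f x y

/-- A player `A`, who may behave differently from Al, is honest in Al's place: on all inputs, every
message that he sends in the course of the interaction with Bob has the density matrix prescribed
by the protocol. He may own any number of private qubits and may do anything else with them. -/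
def HonestAl (A : QPlayer X P.width) : Prop :=
  ∀ (x : X) (y : Y) (t : ℕ), t < P.rounds → Even t →
    (jointRun A P.bob x y (t + 1)).msgDensity = (jointRun P.al P.bob x y (t + 1)).msgDensity

/-- A player `B`, who may behave differently from Bob, is honest in Bob's place. -/
def HonestBob (B : QPlayer Y P.width) : Prop :=
  ∀ (x : X) (y : Y) (t : ℕ), t < P.rounds → Odd t →
    (jointRun P.al B x y (t + 1)).msgDensity = (jointRun P.al P.bob x y (t + 1)).msgDensity

/-- The final state of a player `A` who has played in Al's place. If the last message went to
him, then his last action can move it into his private qubits. -/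
noncomputable def finalAl (A : QPlayer X P.width) (x : X) (y : Y) :
    Matrix (QubitBasis A.mem) (QubitBasis A.mem) ℂ :=
  (jointRun A P.bob x y (P.rounds + 1)).alDensity

/-- The final state of a player `B` who has played in Bob's place. -/
noncomputable def finalBob (B : QPlayer Y P.width) (x : X) (y : Y) :
    Matrix (QubitBasis B.mem) (QubitBasis B.mem) ℂ :=
  (jointRun P.al B x y (P.rounds + 1)).bobDensity

end QProtocol

/-! ### States and their distance -/

open scoped ComplexOrder in
/-- Density matrices: positive semidefinite of trace one. -/
def IsDensityMatrix {n : Type*} [Fintype n] (ρ : Matrix n n ℂ) : Prop :=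
  ρ.PosSemidef ∧ ρ.trace = 1

/-- The trace norm: the sum of the singular values, i.e. of the square roots of the eigenvalues
of `Aᴴ * A`. -/
noncomputable def traceNorm {n : Type*} [Fintype n] [DecidableEq n] (A : Matrix n n ℂ) : ℝ :=
  ∑ i, Real.sqrt ((Matrix.isHermitian_conjTranspose_mul_self A).eigenvalues i)

/-!
The players simulate an optimal deterministic protocol reversibly on the message register: they
compute the transcript bit by bit, write the answer into a further register, and remove the
transcript again, so that the last message depends on the value of the function only. Every
message consists of all these qubits, which gives `O(c)` messages of `O(c)` qubits each.

The simulation is run in superposition with a dummy state that does not depend on the inputs and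
has a small weight. Hence all messages are pure, and the messages for two pairs of inputs are never
orthogonal. A player who returns a pure message is not entangled with it, and since unitary
transformations preserve inner products, the state of his private qubits cannot depend on which of
several non-orthogonal messages he received. So before the last message an honest player has
learnt nothing at all, and the last message tells him the value of the function only.
-/

section TurnRun

variable {S S' : Type*}

/-- The state after `t` steps of a process between two parties, starting from `s`: the step at
time `t` is `f t` if `p t` holds and `g t` otherwise. The schedule `p` is arbitrary so that the two
parties play symmetric roles. -/
def turnRun (p : ℕ → Prop) [DecidablePred p] (f g : ℕ → S → S) (s : S) : ℕ → S
  | 0 => s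
  | t + 1 => if p t then f t (turnRun p f g s t) else g t (turnRun p f g s t)

variable {p : ℕ → Prop} [DecidablePred p] {f g : ℕ → S → S} {s : S} {t : ℕ}

theorem turnRun_succ_of_pos (h : p t) :
    turnRun p f g s (t + 1) = f t (turnRun p f g s t) :=
  if_pos h

theorem turnRun_succ_of_neg (h : ¬p t) :
    turnRun p f g s (t + 1) = g t (turnRun p f g s t) :=
  if_neg h

theorem turnRun_even_two_mul_succ (n : ℕ) :
    turnRun Even f g s (2 * (n + 1)) =
      g (2 * n + 1) (f (2 * n) (turnRun Even f g s (2 * n))) := by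
  rw [mul_add_one, turnRun_succ_of_neg (by simp), turnRun_succ_of_pos (even_two_mul n)]

theorem turnRun_not : turnRun (fun t => ¬p t) g f s t = turnRun p f g s t := by
  induction t with
  | zero => rfl
  | succ t ih => simp only [turnRun, ih, ite_not]

theorem turnRun_induction {P : S → Prop} (hf : ∀ t s, P s → P (f t s))
    (hg : ∀ t s, P s → P (g t s)) (hs : P s) (t : ℕ) : P (turnRun p f g s t) := by
  induction t with
  | zero => exact hs
  | succ t ih =>
    rw [turnRun]
    split_ifs
    exacts [hf t _ ih, hg t _ ih]

theorem map_turnRun (φ : S → S') {f' g' : ℕ → S' → S'} {T : ℕ}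
    (hf : ∀ t < T, Function.Semiconj φ (f t) (f' t))
    (hg : ∀ t < T, Function.Semiconj φ (g t) (g' t)) (ht : t ≤ T) :
    φ (turnRun p f g s t) = turnRun p f' g' (φ s) t := by
  induction t with
  | zero => rfl
  | succ t ih => rw [turnRun, turnRun, apply_ite φ, hf t ht, hg t ht, ih (Nat.le_of_succ_le ht)]

end TurnRun

section Bipartite

open Matrix

open scoped Kronecker ComplexOrder

variable {α κ : Type*} [Fintype α] [Fintype κ]

theorem eq_of_star_dotProduct_eq_one {φ ψ : α → ℂ} (hφ : star φ ⬝ᵥ φ = 1) (hψ : star ψ ⬝ᵥ ψ = 1)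
    (h : star φ ⬝ᵥ ψ = 1) : φ = ψ := by
  have h' : star ψ ⬝ᵥ φ = 1 := by rw [← star_star φ, star_dotProduct_star, h, star_one]
  rw [← sub_eq_zero, ← dotProduct_star_self_eq_zero, star_sub, sub_dotProduct, dotProduct_sub,
    dotProduct_sub, hφ, hψ, h, h']
  simp only [sub_self]

/-- The product vector `φ ⊗ ψ`. -/
def tensorVec {α κ : Type*} (φ : α → ℂ) (ψ : κ → ℂ) : α × κ → ℂ := fun r => φ r.1 * ψ r.2

/-- The reduced density matrix of the second component of a bipartite vector. -/
def reducedDensity {κ : Type*} (χ : α × κ → ℂ) : Matrix κ κ ℂ :=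
  of fun m m' => ∑ i, χ (i, m) * star (χ (i, m'))

theorem reducedDensity_tensorVec {κ : Type*} (φ : α → ℂ) (ψ : κ → ℂ) :
    reducedDensity (tensorVec φ ψ) = (star φ ⬝ᵥ φ) • vecMulVec ψ (star ψ) := by
  ext m m'
  simp only [reducedDensity, tensorVec, of_apply, dotProduct, Matrix.smul_apply, vecMulVec_apply,
    Pi.star_apply, star_mul', smul_eq_mul, Finset.sum_mul]
  exact Finset.sum_congr rfl fun _ _ => by ring

theorem star_tensorVec_dotProduct (φ φ' : α → ℂ) (ψ ψ' : κ → ℂ) :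
    star (tensorVec φ ψ) ⬝ᵥ tensorVec φ' ψ' = (star φ ⬝ᵥ φ') * (star ψ ⬝ᵥ ψ') := by
  simp only [dotProduct, tensorVec, Pi.star_apply, star_mul', Fintype.sum_prod_type,
    Finset.sum_mul_sum]
  exact Finset.sum_congr rfl fun _ _ => Finset.sum_congr rfl fun _ _ => by ring

theorem exists_eq_tensorVec_of_reducedDensity_eq {χ : α × κ → ℂ} {ψ : κ → ℂ}
    (hψ : star ψ ⬝ᵥ ψ = 1) (h : reducedDensity χ = vecMulVec ψ (star ψ)) :
    ∃ φ, χ = tensorVec φ ψ := by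
  classical
  let M : Matrix κ α ℂ := of fun m i => χ (i, m)
  let Q : Matrix κ κ ℂ := vecMulVec ψ (star ψ)
  have hMM : M * Mᴴ = Q := by
    ext m m'
    simp only [Q, ← h, M, reducedDensity, mul_apply, of_apply, conjTranspose_apply]
  have hQQ : Q * Q = Q := by
    rw [vecMulVec_mul_vecMulVec, hψ, one_smul]
  have hM : M = Q * M := by
    rw [← sub_eq_zero, ← Matrix.one_mul M, ← Matrix.mul_assoc, Matrix.mul_one, ← Matrix.sub_mul,
      ← self_mul_conjTranspose_eq_zero, conjTranspose_mul, Matrix.mul_assoc,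
      ← Matrix.mul_assoc M, hMM, ← Matrix.mul_assoc, Matrix.sub_mul, hQQ, Matrix.one_mul, sub_self,
      Matrix.zero_mul]
  refine ⟨star ψ ᵥ* M, funext fun ⟨i, m⟩ => ?_⟩
  calc χ (i, m) = (Q * M) m i := congrFun₂ hM m i
    _ = ψ m * (star ψ ᵥ* M) i := by rw [vecMulVec_mul, vecMulVec_apply]
    _ = tensorVec (star ψ ᵥ* M) ψ (i, m) := mul_comm _ _

variable [DecidableEq α] [DecidableEq κ]

theorem star_unitary_mulVec_dotProduct (U : unitaryGroup α ℂ) (v w : α → ℂ) :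
    star (U.1 *ᵥ v) ⬝ᵥ (U.1 *ᵥ w) = star v ⬝ᵥ w := by
  rw [star_mulVec, ← dotProduct_mulVec, mulVec_mulVec, ← star_eq_conjTranspose,
    mem_unitaryGroup_iff'.1 U.2, one_mulVec]

/-- The unitary transformation `1 ⊗ U`. -/
def oneTensor (α : Type*) [Fintype α] [DecidableEq α] (U : unitaryGroup κ ℂ) :
    unitaryGroup (α × κ) ℂ :=
  ⟨(1 : Matrix α α ℂ) ⊗ₖ U.1, kronecker_mem_unitary (one_mem _) U.2⟩

theorem oneTensor_mulVec_apply (U : unitaryGroup κ ℂ) (χ : α × κ → ℂ) (i : α) (m : κ) :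
    ((oneTensor α U).1 *ᵥ χ) (i, m) = (U.1 *ᵥ fun m' => χ (i, m')) m := by
  simp only [oneTensor, mulVec, dotProduct, kroneckerMap_apply, Fintype.sum_prod_type, one_apply,
    ite_mul, one_mul, zero_mul, Finset.sum_ite_irrel, Finset.sum_const_zero, Finset.sum_ite_eq,
    Finset.mem_univ, if_true]

theorem oneTensor_mulVec_tensorVec (U : unitaryGroup κ ℂ) (φ : α → ℂ) (ψ : κ → ℂ) :
    (oneTensor α U).1 *ᵥ tensorVec φ ψ = tensorVec φ (U.1 *ᵥ ψ) := by
  ext ⟨i, m⟩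
  rw [oneTensor_mulVec_apply]
  exact congrFun (mulVec_smul U.1 (φ i) ψ) m

theorem star_dotProduct_eq_of_mulVec_tensorVec_eq {W : unitaryGroup (α × κ) ℂ}
    {V : unitaryGroup κ ℂ} {φ φ₁ φ₂ : α → ℂ} {ψ₁ ψ₂ : κ → ℂ} (hne : star ψ₁ ⬝ᵥ ψ₂ ≠ 0)
    (h₁ : W.1 *ᵥ tensorVec φ ψ₁ = tensorVec φ₁ (V.1 *ᵥ ψ₁))
    (h₂ : W.1 *ᵥ tensorVec φ ψ₂ = tensorVec φ₂ (V.1 *ᵥ ψ₂)) :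
    star φ₁ ⬝ᵥ φ₂ = star φ ⬝ᵥ φ := by
  refine mul_right_cancel₀ hne ?_
  calc star φ₁ ⬝ᵥ φ₂ * star ψ₁ ⬝ᵥ ψ₂
      = star (tensorVec φ₁ (V.1 *ᵥ ψ₁)) ⬝ᵥ tensorVec φ₂ (V.1 *ᵥ ψ₂) := by
        rw [star_tensorVec_dotProduct, star_unitary_mulVec_dotProduct]
    _ = star φ ⬝ᵥ φ * star ψ₁ ⬝ᵥ ψ₂ := by
        rw [← h₁, ← h₂, star_unitary_mulVec_dotProduct, star_tensorVec_dotProduct]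

/-- No information gain without disturbance: `φ'` cannot depend on `i`, because unitary
transformations preserve the inner products, and those of the `ψ i` do not vanish. -/
theorem exists_common_tensorVec {ι : Type*} {W : unitaryGroup (α × κ) ℂ} {V : unitaryGroup κ ℂ}
    {φ : α → ℂ} {ψ : ι → κ → ℂ} (hφ : star φ ⬝ᵥ φ = 1) (hψ : ∀ i, star (ψ i) ⬝ᵥ ψ i = 1)
    (hne : ∀ i j, star (ψ i) ⬝ᵥ ψ j ≠ 0)
    (hd : ∀ i, reducedDensity (W.1 *ᵥ tensorVec φ (ψ i)) =
      vecMulVec (V.1 *ᵥ ψ i) (star (V.1 *ᵥ ψ i))) :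
    ∃ φ' : α → ℂ, star φ' ⬝ᵥ φ' = 1 ∧
      ∀ i, W.1 *ᵥ tensorVec φ (ψ i) = tensorVec φ' (V.1 *ᵥ ψ i) := by
  obtain _ | ⟨⟨i₀⟩⟩ := isEmpty_or_nonempty ι
  · exact ⟨φ, hφ, isEmptyElim⟩
  have hprod (i : ι) : ∃ φ', W.1 *ᵥ tensorVec φ (ψ i) = tensorVec φ' (V.1 *ᵥ ψ i) :=
    exists_eq_tensorVec_of_reducedDensity_eq
      ((star_unitary_mulVec_dotProduct V _ _).trans (hψ i)) (hd i)
  choose φ' hφ' using hprod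
  have hinner (i j : ι) : star (φ' i) ⬝ᵥ φ' j = 1 :=
    (star_dotProduct_eq_of_mulVec_tensorVec_eq (hne i j) (hφ' i) (hφ' j)).trans hφ
  have hconst (i : ι) : φ' i = φ' i₀ :=
    eq_of_star_dotProduct_eq_one (hinner i i) (hinner i₀ i₀) (hinner i i₀)
  exact ⟨φ' i₀, hinner i₀ i₀, fun i => hconst i ▸ hφ' i⟩

/-- The unitary transformation that permutes the basis vectors by `π`. -/
def permUnitary (π : Equiv.Perm α) : unitaryGroup α ℂ :=
  ⟨(π⁻¹).permMatrix ℂ, by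
    rw [mem_unitaryGroup_iff, star_eq_conjTranspose, conjTranspose_permMatrix, ← permMatrix_mul,
      inv_mul_cancel, permMatrix_one]⟩

theorem permUnitary_mulVec (π : Equiv.Perm α) (v : α → ℂ) :
    (permUnitary π).1 *ᵥ v = v ∘ (π⁻¹ : Equiv.Perm α) :=
  permMatrix_mulVec _

theorem permUnitary_mulVec_single (π : Equiv.Perm α) (i : α) (z : ℂ) :
    (permUnitary π).1 *ᵥ Pi.single i z = Pi.single (π i) z := by
  ext j
  simp only [permUnitary_mulVec, Function.comp_apply, Pi.single_apply, Equiv.Perm.inv_eq_iff_eq]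

theorem exists_unitary_mulVec_single_eq (i : α) {v : α → ℂ} (hv : star v ⬝ᵥ v = 1) :
    ∃ U : unitaryGroup α ℂ, U.1 *ᵥ Pi.single i 1 = v := by
  have horth : Orthonormal ℂ (Set.domRestrict {i} fun _ : α => WithLp.toLp 2 v) := by
    rw [orthonormal_iff_ite]
    rintro ⟨_, rfl⟩ ⟨_, rfl⟩
    rw [if_pos rfl]
    exact (dotProduct_comm _ _).trans hv
  obtain ⟨b, hb⟩ := horth.exists_orthonormalBasis_extension_of_card_eq
    (finrank_euclideanSpace (𝕜 := ℂ) (ι := α))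
  let e := EuclideanSpace.basisFun α ℂ
  refine ⟨⟨e.toBasis.toMatrix b, e.toMatrix_orthonormalBasis_mem_unitary b⟩, ?_⟩
  rw [mulVec_single_one]
  exact congrArg WithLp.ofLp (hb i rfl)

end Bipartite

section UnitaryRun

open Matrix

variable {α κ : Type*} [Fintype α] [DecidableEq α] [Fintype κ] [DecidableEq κ]

/-- The state after `t` steps in which two parties transform a register: at time `t` the unitary
`U t` is applied if `p t` holds, and `V t` otherwise. -/
def unitaryRun (p : ℕ → Prop) [DecidablePred p] (U V : ℕ → unitaryGroup κ ℂ) (ψ : κ → ℂ) :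
    ℕ → κ → ℂ :=
  turnRun p (fun t => mulVec (U t).1) (fun t => mulVec (V t).1) ψ

variable {p : ℕ → Prop} [DecidablePred p]

theorem unitaryRun_succ_of_pos {U V : ℕ → unitaryGroup κ ℂ} {ψ : κ → ℂ} {t : ℕ} (h : p t) :
    unitaryRun p U V ψ (t + 1) = (U t).1 *ᵥ unitaryRun p U V ψ t :=
  turnRun_succ_of_pos h

theorem unitaryRun_succ_of_neg {U V : ℕ → unitaryGroup κ ℂ} {ψ : κ → ℂ} {t : ℕ} (h : ¬p t) :
    unitaryRun p U V ψ (t + 1) = (V t).1 *ᵥ unitaryRun p U V ψ t :=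
  turnRun_succ_of_neg h

theorem star_unitaryRun_dotProduct (U V : ℕ → unitaryGroup κ ℂ) (ψ : κ → ℂ) (t : ℕ) :
    star (unitaryRun p U V ψ t) ⬝ᵥ unitaryRun p U V ψ t = star ψ ⬝ᵥ ψ :=
  turnRun_induction (P := fun χ => star χ ⬝ᵥ χ = star ψ ⬝ᵥ ψ)
    (fun _ _ => (star_unitary_mulVec_dotProduct _ _ _).trans)
    (fun _ _ => (star_unitary_mulVec_dotProduct _ _ _).trans) rfl t

theorem exists_common_unitaryRun {ι : Type*} {W : ℕ → unitaryGroup (α × κ) ℂ}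
    {U : ℕ → unitaryGroup κ ℂ} {V : ι → ℕ → unitaryGroup κ ℂ} {φ : α → ℂ} {ψ : κ → ℂ}
    (hφ : star φ ⬝ᵥ φ = 1) (hψ : star ψ ⬝ᵥ ψ = 1) {T : ℕ}
    (hd : ∀ i, ∀ t < T, p t →
      reducedDensity (unitaryRun p W (oneTensor α ∘ V i) (tensorVec φ ψ) (t + 1)) =
        vecMulVec (unitaryRun p U (V i) ψ (t + 1)) (star (unitaryRun p U (V i) ψ (t + 1))))
    (hne : ∀ i j, ∀ t < T, star (unitaryRun p U (V i) ψ t) ⬝ᵥ unitaryRun p U (V j) ψ t ≠ 0)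
    {t : ℕ} (ht : t ≤ T) :
    ∃ φ' : α → ℂ, star φ' ⬝ᵥ φ' = 1 ∧ ∀ i,
      unitaryRun p W (oneTensor α ∘ V i) (tensorVec φ ψ) t =
        tensorVec φ' (unitaryRun p U (V i) ψ t) := by
  induction t with
  | zero => exact ⟨φ, hφ, fun _ => rfl⟩
  | succ t ih =>
    obtain ⟨φ', hφ', h⟩ := ih (Nat.le_of_succ_le ht)
    by_cases hp : p t
    · obtain ⟨φ'', hφ'', h''⟩ := exists_common_tensorVec (W := W t) (V := U t) hφ'
        (fun i => (star_unitaryRun_dotProduct U (V i) ψ t).trans hψ) (fun i j => hne i j t ht)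
        fun i => by
          rw [← h, ← unitaryRun_succ_of_pos hp, ← unitaryRun_succ_of_pos hp]
          exact hd i t ht hp
      exact ⟨φ'', hφ'', fun i => by
        rw [unitaryRun_succ_of_pos hp, unitaryRun_succ_of_pos hp, h, h'']⟩
    · exact ⟨φ', hφ', fun i => by
        rw [unitaryRun_succ_of_neg hp, unitaryRun_succ_of_neg hp, h, Function.comp_apply,
          oneTensor_mulVec_tensorVec]⟩

end UnitaryRun

section DensityMatrix

open Matrix

open scoped ComplexOrder

variable {n : Type*} [Fintype n]

theorem isDensityMatrix_vecMulVec {ψ : n → ℂ} (hψ : star ψ ⬝ᵥ ψ = 1) :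
    IsDensityMatrix (vecMulVec ψ (star ψ)) :=
  ⟨posSemidef_vecMulVec_self_star ψ, by rw [trace_vecMulVec, dotProduct_comm, hψ]⟩

variable [DecidableEq n]

theorem exists_isDensityMatrix (n : Type*) [Fintype n] [Nonempty n] :
    ∃ ρ : Matrix n n ℂ, IsDensityMatrix ρ := by
  classical
  exact ⟨_, isDensityMatrix_vecMulVec (ψ := Pi.single (Classical.arbitrary n) 1) (by
    rw [dotProduct_single_one, Pi.star_apply, Pi.single_eq_same, star_one])⟩

theorem traceNorm_zero : traceNorm (0 : Matrix n n ℂ) = 0 := by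
  have h : (isHermitian_conjTranspose_mul_self (0 : Matrix n n ℂ)).eigenvalues = 0 := by
    rw [IsHermitian.eigenvalues_eq_zero_iff, Matrix.mul_zero]
  exact Finset.sum_eq_zero fun i _ => by rw [h, Pi.zero_apply, Real.sqrt_zero]

theorem exists_isDensityMatrix_traceNorm_sub_le [Nonempty n] {I J Z : Type*} {g : I → J → Z}
    {ρ : I → J → Matrix n n ℂ} (hρ : ∀ i j, IsDensityMatrix (ρ i j))
    (hg : ∀ i, Function.FactorsThrough (ρ i) (g i)) {ε : ℝ} (hε : 0 ≤ ε) :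
    ∃ σ : I → Z → Matrix n n ℂ, (∀ i z, IsDensityMatrix (σ i z)) ∧
      ∀ i j, traceNorm (ρ i j - σ i (g i j)) ≤ ε := by
  obtain ⟨ρ₀, hρ₀⟩ := exists_isDensityMatrix n
  refine ⟨fun i => Function.extend (g i) (ρ i) fun _ => ρ₀, fun i z => ?_, fun i j => ?_⟩
  · classical
    simp only [Function.extend_def]
    split_ifs
    exacts [hρ i _, hρ₀]
  · simpa only [(hg i).extend_apply, sub_self, traceNorm_zero] using hε

end DensityMatrix

namespace JointState

open Matrix

open scoped ComplexOrder

variable {a k b : ℕ}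

/-- The same joint state with the roles of Al and Bob interchanged. -/
def mirror (ψ : JointState a k b) : JointState b k a := fun s => ψ (s.2.2, s.2.1, s.1)

theorem mirror_applyAl (U : Matrix (QubitBasis a × QubitBasis k) (QubitBasis a × QubitBasis k) ℂ)
    (ψ : JointState a k b) : (applyAl U ψ).mirror = applyBob U ψ.mirror :=
  rfl

theorem mirror_applyBob (U : Matrix (QubitBasis b × QubitBasis k) (QubitBasis b × QubitBasis k) ℂ)
    (ψ : JointState a k b) : (applyBob U ψ).mirror = applyAl U ψ.mirror :=
  rfl

theorem mirror_blank : (blank a k b).mirror = blank b k a := by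
  ext s
  simp only [mirror, blank, Prod.ext_iff]
  exact if_congr (by tauto) rfl rfl

theorem msgDensity_mirror (ψ : JointState a k b) : ψ.mirror.msgDensity = ψ.msgDensity :=
  Matrix.ext fun _ _ => Finset.sum_comm

theorem alDensity_mirror (ψ : JointState a k b) : ψ.mirror.alDensity = ψ.bobDensity :=
  Matrix.ext fun _ _ => Finset.sum_comm

theorem star_mirror_dotProduct (ψ : JointState a k b) :
    star ψ.mirror ⬝ᵥ ψ.mirror = star ψ ⬝ᵥ ψ := by
  let e : QubitBasis b × QubitBasis k × QubitBasis a ≃ QubitBasis a × QubitBasis k × QubitBasis b :=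
    ⟨fun s => (s.2.2, s.2.1, s.1), fun s => (s.2.2, s.2.1, s.1), fun _ => rfl, fun _ => rfl⟩
  exact comp_equiv_dotProduct_comp_equiv (star ψ) ψ e

theorem star_applyAl_dotProduct (U : unitaryGroup (QubitBasis a × QubitBasis k) ℂ)
    (ψ : JointState a k b) : star (applyAl U.1 ψ) ⬝ᵥ applyAl U.1 ψ = star ψ ⬝ᵥ ψ := by
  let e : QubitBasis b × QubitBasis a × QubitBasis k ≃ QubitBasis a × QubitBasis k × QubitBasis b :=
    (Equiv.prodComm _ _).trans (Equiv.prodAssoc _ _ _)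
  have he : applyAl U.1 ψ ∘ e = (oneTensor (QubitBasis b) U).1 *ᵥ (ψ ∘ e) :=
    funext fun ⟨j, r⟩ => (oneTensor_mulVec_apply U (ψ ∘ e) j r).symm
  rw [← comp_equiv_dotProduct_comp_equiv _ _ e, ← comp_equiv_dotProduct_comp_equiv _ ψ e]
  exact (congrArg (fun χ => star χ ⬝ᵥ χ) he).trans (star_unitary_mulVec_dotProduct ..)

theorem star_applyBob_dotProduct (U : unitaryGroup (QubitBasis b × QubitBasis k) ℂ)
    (ψ : JointState a k b) : star (applyBob U.1 ψ) ⬝ᵥ applyBob U.1 ψ = star ψ ⬝ᵥ ψ := by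
  rw [← star_mirror_dotProduct, mirror_applyBob, star_applyAl_dotProduct, star_mirror_dotProduct]

theorem star_blank_dotProduct : star (blank a k b) ⬝ᵥ blank a k b = 1 := by
  simp only [dotProduct, Pi.star_apply, blank, mul_ite, mul_one, mul_zero, Finset.sum_ite_eq',
    Finset.mem_univ, if_true, star_one]

theorem isDensityMatrix_alDensity {ψ : JointState a k b} (h : star ψ ⬝ᵥ ψ = 1) :
    IsDensityMatrix ψ.alDensity := by
  constructor
  · have hsum : ψ.alDensity =
        ∑ m, ∑ j, vecMulVec (fun i => ψ (i, m, j)) (star fun i => ψ (i, m, j)) := by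
      ext i i'
      simp only [alDensity, Matrix.sum_apply, vecMulVec_apply, of_apply, Pi.star_apply]
    rw [hsum]
    exact posSemidef_sum _ fun m _ => posSemidef_sum _ fun j _ => posSemidef_vecMulVec_self_star _
  · simp only [← h, trace, alDensity, diag_apply, of_apply, dotProduct, Fintype.sum_prod_type,
      Pi.star_apply, mul_comm]

theorem isDensityMatrix_bobDensity {ψ : JointState a k b} (h : star ψ ⬝ᵥ ψ = 1) :
    IsDensityMatrix ψ.bobDensity :=
  ψ.alDensity_mirror ▸ isDensityMatrix_alDensity ((star_mirror_dotProduct ψ).trans h)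

/-- The state of Al's qubits and the message, not entangled with Bob's qubits in state `β`. -/
def joinAl (χ : QubitBasis a × QubitBasis k → ℂ) (β : QubitBasis b → ℂ) : JointState a k b :=
  fun s => χ (s.1, s.2.1) * β s.2.2

theorem applyAl_joinAl (U : Matrix (QubitBasis a × QubitBasis k) (QubitBasis a × QubitBasis k) ℂ)
    (χ : QubitBasis a × QubitBasis k → ℂ) (β : QubitBasis b → ℂ) :
    applyAl U (joinAl χ β) = joinAl (U *ᵥ χ) β := by
  ext s
  simp only [applyAl, joinAl, mulVec, dotProduct, Finset.sum_mul, mul_assoc]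

theorem applyBob_oneTensor_joinAl (V : unitaryGroup (QubitBasis k) ℂ)
    (χ : QubitBasis a × QubitBasis k → ℂ) (β : QubitBasis b → ℂ) :
    applyBob (oneTensor (QubitBasis b) V).1 (joinAl χ β) =
      joinAl ((oneTensor (QubitBasis a) V).1 *ᵥ χ) β := by
  ext ⟨i, m, j⟩
  have hsmul : (fun m' => χ (i, m') * β j) = β j • fun m' => χ (i, m') :=
    funext fun _ => mul_comm _ _
  calc applyBob (oneTensor (QubitBasis b) V).1 (joinAl χ β) (i, m, j)
      = (V.1 *ᵥ fun m' => χ (i, m') * β j) m :=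
        oneTensor_mulVec_apply V (fun r => χ (i, r.2) * β r.1) j m
    _ = (V.1 *ᵥ fun m' => χ (i, m')) m * β j := by
      rw [hsmul, mulVec_smul, Pi.smul_apply, smul_eq_mul, mul_comm]
    _ = joinAl ((oneTensor (QubitBasis a) V).1 *ᵥ χ) β (i, m, j) := by
      rw [joinAl, oneTensor_mulVec_apply]

theorem msgDensity_joinAl (χ : QubitBasis a × QubitBasis k → ℂ) {β : QubitBasis b → ℂ}
    (hβ : star β ⬝ᵥ β = 1) : (joinAl χ β).msgDensity = reducedDensity χ := by
  ext m m'
  calc ∑ i, ∑ j, χ (i, m) * β j * star (χ (i, m') * β j)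
      = ∑ i, χ (i, m) * star (χ (i, m')) * (star β ⬝ᵥ β) := by
        simp only [dotProduct, Finset.mul_sum, star_mul', Pi.star_apply]
        exact Finset.sum_congr rfl fun _ _ => Finset.sum_congr rfl fun _ _ => by ring
    _ = reducedDensity χ m m' := by
        simp only [hβ, mul_one, reducedDensity, of_apply]

/-- The blank state of a single register. -/
def blankVec (n : ℕ) : QubitBasis n → ℂ := Pi.single (fun _ => false) 1

theorem star_blankVec_dotProduct (n : ℕ) : star (blankVec n) ⬝ᵥ blankVec n = 1 := by
  rw [blankVec, dotProduct_single_one, Pi.star_apply, Pi.single_eq_same, star_one]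

theorem blank_eq_joinAl :
    blank a k b = joinAl (tensorVec (blankVec a) (blankVec k)) (blankVec b) := by
  ext ⟨i, m, j⟩
  simp only [blank, joinAl, tensorVec, blankVec, Pi.single_apply, Prod.mk.injEq, ite_and, mul_ite,
    mul_one, mul_zero]
  split_ifs <;> rfl

end JointState

section JointRun

open Matrix JointState

variable {X : Type u} {Y : Type v} {Z : Type w} {k : ℕ}

/-- The joint state after the first `t` actions, when Al acts at the times `t` with `p t` and Bob
acts at the other times. -/
noncomputable def jointRunOn (p : ℕ → Prop) [DecidablePred p] (A : QPlayer X k) (B : QPlayer Y k)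
    (x : X) (y : Y) : ℕ → JointState A.mem k B.mem :=
  turnRun p (fun t => applyAl (A.op t x).1) (fun t => applyBob (B.op t y).1) (blank A.mem k B.mem)

theorem jointRun_eq_jointRunOn (A : QPlayer X k) (B : QPlayer Y k) (x : X) (y : Y) (t : ℕ) :
    jointRun A B x y t = jointRunOn Even A B x y t := by
  induction t with
  | zero => rfl
  | succ t ih => rw [jointRun, ih]; rfl

theorem mirror_jointRunOn (p : ℕ → Prop) [DecidablePred p] (A : QPlayer X k) (B : QPlayer Y k)
    (x : X) (y : Y) (t : ℕ) :
    (jointRunOn p A B x y t).mirror = jointRunOn (fun t => ¬p t) B A y x t := by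
  rw [jointRunOn, map_turnRun mirror (fun _ _ => mirror_applyAl _) (fun _ _ => mirror_applyBob _)
    le_rfl, mirror_blank, ← turnRun_not]
  rfl

theorem star_jointRun_dotProduct (A : QPlayer X k) (B : QPlayer Y k) (x : X) (y : Y) (t : ℕ) :
    star (jointRun A B x y t) ⬝ᵥ jointRun A B x y t = 1 := by
  rw [jointRun_eq_jointRunOn]
  exact turnRun_induction (P := fun ψ => star ψ ⬝ᵥ ψ = 1)
    (fun _ _ => (star_applyAl_dotProduct _ _).trans)
    (fun _ _ => (star_applyBob_dotProduct _ _).trans) star_blank_dotProduct t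

end JointRun

namespace QProtocol

variable {X : Type u} {Y : Type v} {Z : Type w}

/-- The protocol reveals to honest players only the values of `f`: the final state of an honest
player depends on the input of the other player through the value of `f` only. -/
def RevealsOnly (P : QProtocol X Y Z) (f : X → Y → Z) : Prop :=
  (∀ A : QPlayer X P.width, P.HonestAl A →
    ∀ x, Function.FactorsThrough (fun y => P.finalAl A x y) fun y => f x y) ∧
  ∀ B : QPlayer Y P.width, P.HonestBob B →
    ∀ y, Function.FactorsThrough (fun x => P.finalBob B x y) fun x => f x y

theorem isDensityMatrix_finalAl (P : QProtocol X Y Z) (A : QPlayer X P.width) (x : X) (y : Y) :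
    IsDensityMatrix (P.finalAl A x y) :=
  JointState.isDensityMatrix_alDensity (star_jointRun_dotProduct ..)

theorem isDensityMatrix_finalBob (P : QProtocol X Y Z) (B : QPlayer Y P.width) (x : X) (y : Y) :
    IsDensityMatrix (P.finalBob B x y) :=
  JointState.isDensityMatrix_bobDensity (star_jointRun_dotProduct ..)

end QProtocol

/-- The permutation that adds the bits `g r` to the first register, where `r` is the state of the
second one. -/
def xorInto {n : ℕ} {β : Type*} (g : β → Fin n → Bool) : Equiv.Perm ((Fin n → Bool) × β) :=
  Function.Involutive.toPerm (fun s => (fun i => xor (s.1 i) (g s.2 i), s.2)) fun s => by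
    simp only [Bool.xor_assoc, Bool.xor_self, Bool.xor_false]

theorem xorInto_blank {n : ℕ} {β : Type*} (g : β → Fin n → Bool) (r : β) :
    xorInto g (fun _ => false, r) = (g r, r) := by
  change (fun i => xor false (g r i), r) = (g r, r)
  simp only [Bool.false_xor]

theorem xorInto_id_inv_self {n : ℕ} (s : Fin n → Bool) :
    (xorInto id)⁻¹ (s, s) = (fun _ => false, s) :=
  Equiv.Perm.inv_eq_iff_eq.2 (xorInto_blank id s).symm

section CopyProtocol

open Matrix JointState

variable {X : Type u} {Y : Type v} {Z : Type w} {k b T : ℕ}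

/-- The player who acts on the message alone before time `T`, and from then on copies the message
into his private qubits. -/
noncomputable abbrev copyPlayer {I : Type*} (T : ℕ) (U : I → ℕ → unitaryGroup (QubitBasis k) ℂ) :
    QPlayer I k where
  mem := k
  op t i := if t < T then oneTensor _ (U i t) else permUnitary (xorInto id)

theorem copyPlayer_op_of_lt {I : Type*} (U : I → ℕ → unitaryGroup (QubitBasis k) ℂ) {t : ℕ}
    (ht : t < T) (i : I) : (copyPlayer T U).op t i = oneTensor _ (U i t) :=
  if_pos ht

theorem copyPlayer_op_of_le {I : Type*} (U : I → ℕ → unitaryGroup (QubitBasis k) ℂ) {t : ℕ}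
    (ht : T ≤ t) (i : I) : (copyPlayer T U).op t i = permUnitary (xorInto id) :=
  if_neg ht.not_gt

variable {U : X → ℕ → unitaryGroup (QubitBasis k) ℂ} {V : Y → ℕ → unitaryGroup (QubitBasis k) ℂ}
  {p : ℕ → Prop} [DecidablePred p]

theorem jointRunOn_copyPlayer_right (A : QPlayer X k) (x : X) (y : Y) {t : ℕ} (ht : t ≤ T) :
    jointRunOn p A (copyPlayer T V) x y t =
      joinAl (unitaryRun p (fun t => A.op t x) (oneTensor _ ∘ V y)
        (tensorVec (blankVec A.mem) (blankVec k)) t) (blankVec k) := by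
  rw [jointRunOn, blank_eq_joinAl]
  refine (map_turnRun (fun χ => joinAl χ (blankVec k)) (fun _ _ χ => ?_) (fun t ht χ => ?_) ht).symm
  · rw [applyAl_joinAl]
  · rw [copyPlayer_op_of_lt V ht, applyBob_oneTensor_joinAl, Function.comp_apply]

theorem jointRunOn_copyPlayer (x : X) (y : Y) {t : ℕ} (ht : t ≤ T) :
    jointRunOn p (copyPlayer T U) (copyPlayer T V) x y t =
      joinAl (tensorVec (blankVec k) (unitaryRun p (U x) (V y) (blankVec k) t)) (blankVec k) := by
  rw [jointRunOn, blank_eq_joinAl]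
  refine (map_turnRun (fun ψ => joinAl (tensorVec (blankVec k) ψ) (blankVec k)) (fun t ht ψ => ?_)
    (fun t ht ψ => ?_) ht).symm
  · rw [copyPlayer_op_of_lt U ht, applyAl_joinAl, oneTensor_mulVec_tensorVec]
  · rw [copyPlayer_op_of_lt V ht, applyBob_oneTensor_joinAl, oneTensor_mulVec_tensorVec]

theorem msgDensity_jointRunOn_copyPlayer (x : X) (y : Y) {t : ℕ} (ht : t ≤ T) :
    (jointRunOn p (copyPlayer T U) (copyPlayer T V) x y t).msgDensity =
      vecMulVec (unitaryRun p (U x) (V y) (blankVec k) t)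
        (star (unitaryRun p (U x) (V y) (blankVec k) t)) := by
  rw [jointRunOn_copyPlayer x y ht, msgDensity_joinAl _ (star_blankVec_dotProduct k),
    reducedDensity_tensorVec, star_blankVec_dotProduct, one_smul]

theorem exists_jointRunOn_eq_of_msgDensity_eq {A : QPlayer X k} {x : X}
    (hd : ∀ y, ∀ t < T, p t → (jointRunOn p A (copyPlayer T V) x y (t + 1)).msgDensity =
      (jointRunOn p (copyPlayer T U) (copyPlayer T V) x y (t + 1)).msgDensity)
    (hne : ∀ y y', ∀ t < T, star (unitaryRun p (U x) (V y) (blankVec k) t) ⬝ᵥ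
      unitaryRun p (U x) (V y') (blankVec k) t ≠ 0) :
    ∃ φ, ∀ y, jointRunOn p A (copyPlayer T V) x y T =
      joinAl (tensorVec φ (unitaryRun p (U x) (V y) (blankVec k) T)) (blankVec k) := by
  obtain ⟨φ, -, hφ⟩ := exists_common_unitaryRun (W := fun t => A.op t x)
    (star_blankVec_dotProduct A.mem) (star_blankVec_dotProduct k)
    (fun y t ht hp => by
      rw [← msgDensity_jointRunOn_copyPlayer x y ht, ← hd y t ht hp,
        jointRunOn_copyPlayer_right A x y ht, msgDensity_joinAl _ (star_blankVec_dotProduct k)])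
    hne le_rfl
  exact ⟨φ, fun y => by rw [jointRunOn_copyPlayer_right A x y le_rfl, hφ]⟩

theorem jointRunOn_copyPlayer_right_congr {A : QPlayer X k} {x : X} {y y' : Y}
    (h : jointRunOn p A (copyPlayer T V) x y T = jointRunOn p A (copyPlayer T V) x y' T) (n : ℕ) :
    jointRunOn p A (copyPlayer T V) x y (T + n) = jointRunOn p A (copyPlayer T V) x y' (T + n) := by
  induction n with
  | zero => exact h
  | succ n ih =>
    rw [jointRunOn, jointRunOn] at ih ⊢
    rw [← Nat.add_assoc]
    by_cases hp : p (T + n)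
    · rw [turnRun_succ_of_pos hp, turnRun_succ_of_pos hp, ih]
    · rw [turnRun_succ_of_neg hp, turnRun_succ_of_neg hp, ih,
        copyPlayer_op_of_le V (Nat.le_add_right T n), copyPlayer_op_of_le V (Nat.le_add_right T n)]

theorem jointRunOn_copyPlayer_right_eq_of_unitaryRun_eq {A : QPlayer X k} {x : X}
    (hd : ∀ y, ∀ t < T, p t → (jointRunOn p A (copyPlayer T V) x y (t + 1)).msgDensity =
      (jointRunOn p (copyPlayer T U) (copyPlayer T V) x y (t + 1)).msgDensity)
    (hne : ∀ y y', ∀ t < T, star (unitaryRun p (U x) (V y) (blankVec k) t) ⬝ᵥ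
      unitaryRun p (U x) (V y') (blankVec k) t ≠ 0) {y y' : Y}
    (h : unitaryRun p (U x) (V y) (blankVec k) T = unitaryRun p (U x) (V y') (blankVec k) T)
    (n : ℕ) :
    jointRunOn p A (copyPlayer T V) x y (T + n) = jointRunOn p A (copyPlayer T V) x y' (T + n) := by
  obtain ⟨φ, hφ⟩ := exists_jointRunOn_eq_of_msgDensity_eq hd hne
  exact jointRunOn_copyPlayer_right_congr (by rw [hφ, hφ, h]) n

/-- The protocol in which the players transform the message alone before time `T`, and then both
copy it into their private qubits. -/
noncomputable abbrev copyProtocol (T : ℕ) (U : X → ℕ → unitaryGroup (QubitBasis k) ℂ)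
    (V : Y → ℕ → unitaryGroup (QubitBasis k) ℂ) (out : QubitBasis k → Z) : QProtocol X Y Z where
  width := k
  rounds := T + 1
  al := copyPlayer T U
  bob := copyPlayer T V
  alOut _ := out
  bobOut _ := out

variable {out : QubitBasis k → Z} {f : X → Y → Z}

theorem revealsOnly_copyProtocol
    (hne : ∀ x y x' y', ∀ t < T, star (unitaryRun Even (U x) (V y) (blankVec k) t) ⬝ᵥ
      unitaryRun Even (U x') (V y') (blankVec k) t ≠ 0)
    (hT : ∀ x y x' y', f x y = f x' y' → unitaryRun Even (U x) (V y) (blankVec k) T =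
      unitaryRun Even (U x') (V y') (blankVec k) T) :
    (copyProtocol T U V out).RevealsOnly f := by
  constructor
  · intro A hA x y y' hf
    have hd : ∀ y, ∀ t < T, Even t →
        (jointRunOn Even A (copyPlayer T V) x y (t + 1)).msgDensity =
          (jointRunOn Even (copyPlayer T U) (copyPlayer T V) x y (t + 1)).msgDensity :=
      fun y t ht he => by
        simpa only [jointRun_eq_jointRunOn] using hA x y t (Nat.lt_succ_of_lt ht) he
    simp only [QProtocol.finalAl, jointRun_eq_jointRunOn]
    rw [jointRunOn_copyPlayer_right_eq_of_unitaryRun_eq hd (fun y y' => hne x y x y')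
      (hT x y x y' hf) 2]
  · intro B hB y x x' hf
    have hd : ∀ x, ∀ t < T, ¬Even t →
        (jointRunOn (fun t => ¬Even t) B (copyPlayer T U) y x (t + 1)).msgDensity =
          (jointRunOn (fun t => ¬Even t) (copyPlayer T V) (copyPlayer T U) y x
            (t + 1)).msgDensity :=
      fun x t ht he => by
        simpa only [jointRun_eq_jointRunOn, ← mirror_jointRunOn, msgDensity_mirror] using
          hB x y t (Nat.lt_succ_of_lt ht) (Nat.not_even_iff_odd.1 he)
    have hrun : ∀ x t, unitaryRun (fun t => ¬Even t) (V y) (U x) (blankVec k) t =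
        unitaryRun Even (U x) (V y) (blankVec k) t := fun _ _ => turnRun_not
    simp only [QProtocol.finalBob, jointRun_eq_jointRunOn, ← alDensity_mirror, mirror_jointRunOn]
    rw [jointRunOn_copyPlayer_right_eq_of_unitaryRun_eq hd
      (fun x x' t ht => by simpa only [hrun] using hne x y x' y t ht)
      (by simpa only [hrun] using hT x y x' y hf) 2]

theorem applyAl_permUnitary_xorInto_id (ψ : JointState k k b) (m : QubitBasis k)
    (j : QubitBasis b) :
    applyAl (permUnitary (xorInto id)).1 ψ (m, m, j) = ψ (fun _ => false, m, j) := by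
  change ((permUnitary (xorInto id)).1 *ᵥ fun r => ψ (r.1, r.2, j)) (m, m) = _
  rw [permUnitary_mulVec, Function.comp_apply, xorInto_id_inv_self]

theorem jointRun_copyPlayer_add_two (hT : Even T) (x : X) (y : Y) (m : QubitBasis k) :
    jointRun (copyPlayer T U) (copyPlayer T V) x y (T + 2) (m, m, m) =
      unitaryRun Even (U x) (V y) (blankVec k) T m := by
  have hT' : ¬Even (T + 1) := Nat.not_even_iff_odd.2 hT.add_one
  calc jointRun (copyPlayer T U) (copyPlayer T V) x y (T + 2) (m, m, m)
      = applyAl (permUnitary (xorInto id)).1 (applyAl (permUnitary (xorInto id)).1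
          (jointRunOn Even (copyPlayer T U) (copyPlayer T V) x y T)).mirror (m, m, m) := by
        rw [jointRun, if_neg hT', jointRun, if_pos hT, jointRun_eq_jointRunOn,
          copyPlayer_op_of_le U le_rfl, copyPlayer_op_of_le V (Nat.le_succ T)]
        rfl
    _ = jointRunOn Even (copyPlayer T U) (copyPlayer T V) x y T
          (fun _ => false, m, fun _ => false) := by
        rw [applyAl_permUnitary_xorInto_id, mirror, applyAl_permUnitary_xorInto_id]
    _ = unitaryRun Even (U x) (V y) (blankVec k) T m := by
        rw [jointRunOn_copyPlayer x y le_rfl, joinAl, tensorVec, blankVec, Pi.single_eq_same,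
          one_mul, mul_one]

theorem norm_sq_unitaryRun_le_successProb (hT : Even T) (f : X → Y → Z) {x : X} {y : Y}
    {m : QubitBasis k} (hm : out m = f x y) :
    ‖unitaryRun Even (U x) (V y) (blankVec k) T m‖ ^ 2 ≤
      (copyProtocol T U V out).successProb f x y := by
  have hle := Finset.single_le_sum (s := Finset.univ)
    (f := fun s : QubitBasis k × QubitBasis k × QubitBasis k =>
      open Classical in if out s.1 = f x y ∧ out s.2.2 = f x y then
        ‖jointRun (copyPlayer T U) (copyPlayer T V) x y (T + 2) s‖ ^ 2
      else 0) (fun _ _ => by split_ifs <;> positivity) (Finset.mem_univ (m, m, m))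
  simp only [hm, and_self, if_true, jointRun_copyPlayer_add_two hT] at hle
  exact hle

end CopyProtocol

theorem exists_sq_add_sq_eq_one {ε : ℝ} (hε : 0 < ε) :
    ∃ p q : ℝ, 1 - ε ≤ p ^ 2 ∧ 0 < q ∧ p ^ 2 + q ^ 2 = 1 := by
  have hδ : 0 < min ε 1 := lt_min hε one_pos
  have hp : √(1 - min ε 1) ^ 2 = 1 - min ε 1 := Real.sq_sqrt (sub_nonneg.2 (min_le_right _ _))
  refine ⟨√(1 - min ε 1), √(min ε 1), ?_, Real.sqrt_pos.2 hδ, ?_⟩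
  · exact (sub_le_sub_left (min_le_left _ _) _).trans_eq hp.symm
  · rw [hp, Real.sq_sqrt hδ.le, sub_add_cancel]

section Dummy

open Matrix

variable {S α : Type*} [DecidableEq α]

/-- The superposition of the states `s` and `none`, where `none` is a dummy state that does not
depend on the inputs, encoded by the basis states `ι (some s)` and `ι none`. -/
def withDummy (ι : Option S ↪ α) (p q : ℝ) (s : S) : α → ℂ :=
  Pi.single (ι (some s)) (p : ℂ) + Pi.single (ι none) (q : ℂ)

variable (ι : Option S ↪ α) (p q : ℝ)

theorem withDummy_apply_some [DecidableEq S] (s s' : S) :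
    withDummy ι p q s' (ι (some s)) = (if s = s' then p else 0 : ℝ) := by
  rw [withDummy, Pi.add_apply, Pi.single_eq_of_ne (ι.injective.ne (Option.some_ne_none s)),
    add_zero, Pi.single_apply]
  simp only [ι.injective.eq_iff, Option.some_inj]
  split_ifs
  exacts [rfl, Complex.ofReal_zero.symm]

theorem withDummy_apply_none (s : S) : withDummy ι p q s (ι none) = q := by
  rw [withDummy, Pi.add_apply, Pi.single_eq_same,
    Pi.single_eq_of_ne (ι.injective.ne (Option.some_ne_none s).symm), zero_add]

variable [Fintype α]

theorem star_withDummy_dotProduct [DecidableEq S] (s s' : S) :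
    star (withDummy ι p q s) ⬝ᵥ withDummy ι p q s' =
      ((if s = s' then p ^ 2 else 0) + q ^ 2 : ℝ) := by
  rw [withDummy, star_add, ← Pi.single_star, ← Pi.single_star, add_dotProduct, single_dotProduct,
    single_dotProduct, withDummy_apply_none, withDummy_apply_some]
  split_ifs <;> simp [sq]

/-- The unitary transformation that permutes the basis states encoding elements of `S` and fixes the
dummy state and the unused basis states. -/
noncomputable def liftPerm (ι : Option S ↪ α) (σ : Equiv.Perm S) : unitaryGroup α ℂ :=
  permUnitary (Equiv.Perm.viaEmbedding (Equiv.optionCongr σ) ι)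

theorem liftPerm_mulVec_withDummy (σ : Equiv.Perm S) (s : S) :
    (liftPerm ι σ).1 *ᵥ withDummy ι p q s = withDummy ι p q (σ s) := by
  rw [withDummy, liftPerm, mulVec_add, permUnitary_mulVec_single, permUnitary_mulVec_single,
    Equiv.Perm.viaEmbedding_apply, Equiv.Perm.viaEmbedding_apply]
  rfl

end Dummy

/-- A reversible two-party protocol: starting from the state `start`, the players alternately
permute the states in `S`. The permutation applied at time `t` depends on the input of the player
whose turn it is; Al acts at the even times. -/
structure RevProtocol (X : Type u) (Y : Type v) (S : Type w) : Type (max u v w) where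
  al : X → ℕ → Equiv.Perm S
  bob : Y → ℕ → Equiv.Perm S
  start : S

namespace RevProtocol

open Matrix JointState

variable {X : Type u} {Y : Type v} {Z : Type w} {S : Type*} (R : RevProtocol X Y S)

/-- The state after `t` steps. -/
def run (x : X) (y : Y) : ℕ → S := turnRun Even (fun t => R.al x t) (fun t => R.bob y t) R.start

/-- Al's quantum version of the permutations: `H` is applied in addition before his first step, in
order to bring in the dummy state. -/
noncomputable def quantumAl {α : Type*} [Fintype α] [DecidableEq α] (ι : Option S ↪ α)
    (H : unitaryGroup α ℂ) (x : X) (t : ℕ) : unitaryGroup α ℂ :=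
  if t = 0 then liftPerm ι (R.al x t) * H else liftPerm ι (R.al x t)

theorem unitaryRun_quantumAl_succ {α : Type*} [Fintype α] [DecidableEq α] {ι : Option S ↪ α}
    {H : unitaryGroup α ℂ} {ψ : α → ℂ} {p q : ℝ} (hH : H.1 *ᵥ ψ = withDummy ι p q R.start)
    (x : X) (y : Y) (t : ℕ) :
    unitaryRun Even (R.quantumAl ι H x) (fun t => liftPerm ι (R.bob y t)) ψ (t + 1) =
      withDummy ι p q (R.run x y (t + 1)) := by
  induction t with
  | zero =>
    rw [unitaryRun_succ_of_pos Even.zero, quantumAl, if_pos rfl, UnitaryGroup.mul_val,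
      ← mulVec_mulVec]
    exact (congrArg _ hH).trans (liftPerm_mulVec_withDummy ..)
  | succ t ih =>
    by_cases ht : Even (t + 1)
    · rw [unitaryRun_succ_of_pos ht, ih, quantumAl, if_neg t.succ_ne_zero,
        liftPerm_mulVec_withDummy, run, turnRun_succ_of_pos ht]
    · rw [unitaryRun_succ_of_neg ht, ih, liftPerm_mulVec_withDummy, run, turnRun_succ_of_neg ht]

theorem exists_quantum_protocol [Fintype S] {k T : ℕ} (hS : Fintype.card S < 2 ^ k) (hT : Even T)
    (hT₀ : T ≠ 0) {f : X → Y → Z} {out : S → Z} (hout : ∀ x y, out (R.run x y T) = f x y)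
    (hf : ∀ x y x' y', f x y = f x' y' → R.run x y T = R.run x' y' T) {ε : ℝ} (hε : 0 < ε) :
    ∃ P : QProtocol X Y Z,
      P.cost = (T + 1) * k ∧ P.ComputesWithError f ε ∧ P.RevealsOnly f := by
  classical
  obtain ⟨ι⟩ : Nonempty (Option S ↪ QubitBasis k) :=
    Function.Embedding.nonempty_of_card_le <| by
      rwa [Fintype.card_option, Fintype.card_fun, Fintype.card_bool, Fintype.card_fin]
  obtain ⟨p, q, hp, hq, hpq⟩ := exists_sq_add_sq_eq_one hε
  obtain ⟨H, hH⟩ : ∃ H : unitaryGroup (QubitBasis k) ℂ,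
      H.1 *ᵥ blankVec k = withDummy ι p q R.start :=
    exists_unitary_mulVec_single_eq _ <| by
      rw [star_withDummy_dotProduct, if_pos rfl, hpq, Complex.ofReal_one]
  have hrun := R.unitaryRun_quantumAl_succ hH
  obtain ⟨n, rfl⟩ := Nat.exists_eq_succ_of_ne_zero hT₀
  refine ⟨copyProtocol (n + 1) (R.quantumAl ι H) (fun y t => liftPerm ι (R.bob y t))
    fun m => out ((Function.invFun ι m).getD R.start), rfl, fun x y => ?_,
    revealsOnly_copyProtocol (fun x y x' y' t _ => ?_) fun x y x' y' h => ?_⟩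
  · refine hp.trans (Eq.trans_le ?_ (norm_sq_unitaryRun_le_successProb hT f (m := ι (some
      (R.run x y (n + 1)))) ?_))
    · rw [hrun, withDummy_apply_some, if_pos rfl, Complex.norm_real, Real.norm_eq_abs, sq_abs]
    · rw [Function.leftInverse_invFun ι.injective, Option.getD_some, hout]
  · obtain _ | t := t
    · exact (star_blankVec_dotProduct k).trans_ne one_ne_zero
    · rw [hrun, hrun, star_withDummy_dotProduct]
      exact Complex.ofReal_ne_zero.2 (by split_ifs <;> positivity)
  · rw [hrun, hrun, hf x y x' y' h]

end RevProtocol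

namespace DetTree

variable {X : Type u} {Y : Type v} {Z : Type w}

/-- The subtree reached when the bit `b` is announced. A leaf stays where it is, so that all
branches can be prolonged to the same length. -/
def next : DetTree X Y Z → Bool → DetTree X Y Z
  | leaf z, _ => leaf z
  | al _ child, b => child b
  | bob _ child, b => child b

/-- Al's contribution to the announced bit, which is `false` when it is not his turn. -/
def alBit : DetTree X Y Z → X → Bool
  | al bit _, x => bit x
  | _, _ => false

/-- Bob's contribution to the announced bit, which is `false` when it is not his turn. -/
def bobBit : DetTree X Y Z → Y → Bool
  | bob bit _, y => bit y
  | _, _ => false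

/-- The announced bit, as the sum of two contributions each known to one of the players. -/
def bit (t : DetTree X Y Z) (x : X) (y : Y) : Bool := xor (t.alBit x) (t.bobBit y)

/-- The answer at the leftmost leaf; at a leaf this is the answer of the protocol. -/
def value : DetTree X Y Z → Z
  | leaf z => z
  | al _ child => (child false).value
  | bob _ child => (child false).value

theorem depth_next_le (t : DetTree X Y Z) (b : Bool) : (t.next b).depth ≤ t.depth - 1 := by
  cases t <;> cases b <;> simp [next, depth]

theorem eval_next_bit (t : DetTree X Y Z) (x : X) (y : Y) :
    (t.next (t.bit x y)).eval x y = t.eval x y := by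
  cases t <;> simp [next, bit, alBit, bobBit, eval]

theorem eval_eq_value {t : DetTree X Y Z} (h : t.depth = 0) (x : X) (y : Y) :
    t.eval x y = t.value := by
  cases t with
  | leaf z => rfl
  | al | bob => exact absurd h (Nat.succ_ne_zero _)

/-- The node reached after `i` bits on inputs `x`, `y`. -/
def node (t : DetTree X Y Z) (x : X) (y : Y) : ℕ → DetTree X Y Z
  | 0 => t
  | i + 1 => (t.node x y i).next ((t.node x y i).bit x y)

theorem eval_node (t : DetTree X Y Z) (x : X) (y : Y) (i : ℕ) :
    (t.node x y i).eval x y = t.eval x y := by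
  induction i with
  | zero => rfl
  | succ i ih => rw [node, eval_next_bit, ih]

theorem depth_node_le (t : DetTree X Y Z) (x : X) (y : Y) (i : ℕ) :
    (t.node x y i).depth ≤ t.depth - i := by
  induction i with
  | zero => exact le_rfl
  | succ i ih => exact (depth_next_le ..).trans (Nat.sub_le_sub_right ih 1)

theorem value_node {t : DetTree X Y Z} {c : ℕ} (hc : t.depth ≤ c) (x : X) (y : Y) :
    (t.node x y c).value = t.eval x y := by
  have hleaf : (t.node x y c).depth = 0 :=
    Nat.le_zero.1 ((t.depth_node_le x y c).trans_eq (Nat.sub_eq_zero_of_le hc))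
  rw [← eval_eq_value hleaf x y, eval_node]

section Transcript

variable {c : ℕ}

/-- The node reached after the first `i` bits of the transcript `w`. -/
def walk (t : DetTree X Y Z) (w : Fin c → Bool) : ℕ → DetTree X Y Z
  | 0 => t
  | i + 1 => if h : i < c then (t.walk w i).next (w ⟨i, h⟩) else t.walk w i

variable (t : DetTree X Y Z)

theorem walk_congr {w w' : Fin c → Bool} {i : ℕ} (h : ∀ j : Fin c, j < i → w j = w' j) :
    t.walk w i = t.walk w' i := by
  induction i with
  | zero => rfl
  | succ i ih =>
    rw [walk, walk, ih fun j hj => h j (Nat.lt_succ_of_lt hj)]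
    split_ifs with hi
    · rw [h ⟨i, hi⟩ (Nat.lt_succ_self i)]
    · rfl

theorem walk_update (w : Fin c → Bool) (i : Fin c) (b : Bool) :
    t.walk (Function.update w i b) i = t.walk w i :=
  t.walk_congr fun _ hj => Function.update_of_ne (Fin.ne_of_lt hj) b w

/-- Addition to the bit number `i` of a transcript of a bit which depends on the node described by
the bits before it. -/
def flip (i : Fin c) (g : DetTree X Y Z → Bool) : Equiv.Perm (Fin c → Bool) :=
  Function.Involutive.toPerm (fun w => Function.update w i (xor (w i) (g (t.walk w i)))) fun w => by
    simp only [walk_update, Function.update_self, Function.update_idem, Bool.xor_assoc,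
      Bool.xor_self, Bool.xor_false, Function.update_eq_self]

theorem flip_apply (i : Fin c) (g : DetTree X Y Z → Bool) (w : Fin c → Bool) :
    t.flip i g w = Function.update w i (xor (w i) (g (t.walk w i))) := rfl

theorem flip_flip_self (i : Fin c) (g : DetTree X Y Z → Bool) (w : Fin c → Bool) :
    t.flip i g (t.flip i g w) = w :=
  (t.flip i g).left_inv w

theorem flip_bobBit_flip_alBit (x : X) (y : Y) (i : Fin c) (w : Fin c → Bool) :
    t.flip i (fun n => n.bobBit y) (t.flip i (fun n => n.alBit x) w) =
      t.flip i (fun n => n.bit x y) w := by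
  simp only [flip_apply, walk_update, Function.update_self, Function.update_idem, Bool.xor_assoc,
    bit]

/-- The first `j` bits of the transcript on inputs `x`, `y`, padded with `false`. -/
def partialTranscript (x : X) (y : Y) (j : ℕ) : Fin c → Bool :=
  fun i => if i < j then (t.node x y i).bit x y else false

theorem partialTranscript_zero (x : X) (y : Y) :
    t.partialTranscript x y 0 = fun _ : Fin c => false :=
  funext fun i => if_neg (Nat.not_lt_zero i)

theorem walk_partialTranscript (x : X) (y : Y) {i j : ℕ} (hij : i ≤ j) (hi : i ≤ c) :
    t.walk (t.partialTranscript x y j : Fin c → Bool) i = t.node x y i := by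
  induction i with
  | zero => rfl
  | succ i ih =>
    rw [walk, dif_pos (Nat.lt_of_succ_le hi), ih (Nat.le_of_succ_le hij) (Nat.le_of_succ_le hi),
      partialTranscript, if_pos (Nat.lt_of_succ_le hij), node]

theorem flip_partialTranscript (x : X) (y : Y) (i : Fin c) :
    t.flip i (fun n => n.bit x y) (t.partialTranscript x y i) =
      t.partialTranscript x y (i + 1) := by
  ext j
  rw [flip_apply, walk_partialTranscript t x y le_rfl i.2.le]
  obtain rfl | hj := eq_or_ne j i
  · simp [partialTranscript]
  · have hlt : (j : ℕ) < i + 1 ↔ (j : ℕ) < i := by omega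
    rw [Function.update_of_ne hj]
    simp only [partialTranscript, hlt]

theorem flip_partialTranscript_succ (x : X) (y : Y) (i : Fin c) :
    t.flip i (fun n => n.bit x y) (t.partialTranscript x y (i + 1)) =
      t.partialTranscript x y i := by
  rw [← flip_partialTranscript, flip_flip_self]

/-- The answer described by a full transcript. -/
def answer (w : Fin c → Bool) : Z := (t.walk w c).value

variable {t} in
theorem answer_partialTranscript (hc : t.depth ≤ c) (x : X) (y : Y) :
    t.answer (t.partialTranscript x y c : Fin c → Bool) = t.eval x y := by
  rw [answer, walk_partialTranscript t x y le_rfl le_rfl, value_node hc]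

end Transcript

section Simulation

variable (t : DetTree X Y Z)

/-- The states of the reversible simulation: a register for the answer, and a transcript. An answer
is represented by some transcript that leads to it. -/
abbrev SimState : Type := (Fin t.depth → Bool) × (Fin t.depth → Bool)

/-- Addition to the answer register of the representative of the answer that the transcript
describes. -/
noncomputable def writeAnswer : Equiv.Perm t.SimState :=
  xorInto fun w => Function.invFun t.answer (t.answer w)

/-- The move in round `r`: the rounds before `t.depth` compute the bits of the transcript one after
another, the round `t.depth` writes the answer, and the rounds after it remove the bits of the
transcript in the opposite order. -/
def simMove (write : Equiv.Perm t.SimState) (g : DetTree X Y Z → Bool) (r : ℕ) :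
    Equiv.Perm t.SimState :=
  if h : min r (2 * t.depth - r) < t.depth then
    (Equiv.refl _).prodCongr (t.flip ⟨min r (2 * t.depth - r), h⟩ g)
  else write

/-- The reversible simulation of a deterministic protocol. A round consists of two steps, in which
both players add their contributions to the same bit. -/
noncomputable def simulation : RevProtocol X Y t.SimState where
  al x n := t.simMove t.writeAnswer (fun v => v.alBit x) (n / 2)
  bob y n := t.simMove 1 (fun v => v.bobBit y) (n / 2)
  start := (fun _ => false, fun _ => false)

variable {t} {x : X} {y : Y}

theorem run_simulation_two_mul_succ (r : ℕ) :
    t.simulation.run x y (2 * (r + 1)) = t.simMove 1 (fun v => v.bobBit y) r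
      (t.simMove t.writeAnswer (fun v => v.alBit x) r (t.simulation.run x y (2 * r))) := by
  rw [RevProtocol.run, turnRun_even_two_mul_succ]
  have h₁ : (2 * r + 1) / 2 = r := by omega
  have h₂ : 2 * r / 2 = r := by omega
  simp only [simulation, h₁, h₂]

theorem run_simulation_succ_of_eq {r : ℕ} {i : Fin t.depth} (hi : min r (2 * t.depth - r) = i)
    {a w : Fin t.depth → Bool} (h : t.simulation.run x y (2 * r) = (a, w)) :
    t.simulation.run x y (2 * (r + 1)) = (a, t.flip i (fun v => v.bit x y) w) := by
  rw [run_simulation_two_mul_succ, h, ← flip_bobBit_flip_alBit]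
  simp only [simMove, hi, i.2, dif_pos, Fin.eta, Equiv.prodCongr_apply, Prod.map_apply,
    Equiv.refl_apply]

theorem run_simulation_of_le {r : ℕ} (hr : r ≤ t.depth) :
    t.simulation.run x y (2 * r) = (fun _ => false, t.partialTranscript x y r) := by
  induction r with
  | zero => rw [partialTranscript_zero]; rfl
  | succ r ih =>
    rw [run_simulation_succ_of_eq (i := ⟨r, hr⟩) (by simp only; omega)
      (ih (Nat.le_of_succ_le hr)), ← flip_partialTranscript t x y ⟨r, hr⟩]

theorem run_simulation_depth_add {j : ℕ} (hj : j ≤ t.depth) :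
    t.simulation.run x y (2 * (t.depth + 1 + j)) =
      (Function.invFun t.answer (t.eval x y), t.partialTranscript x y (t.depth - j)) := by
  induction j with
  | zero =>
    have hmid : ¬min t.depth (2 * t.depth - t.depth) < t.depth := by omega
    rw [add_zero, run_simulation_two_mul_succ, run_simulation_of_le le_rfl, simMove, simMove,
      dif_neg hmid, dif_neg hmid, writeAnswer, xorInto_blank, answer_partialTranscript le_rfl]
    rfl
  | succ j ih =>
    obtain ⟨i, hi⟩ : ∃ i : Fin t.depth, (i : ℕ) = t.depth - (j + 1) :=
      ⟨⟨t.depth - (j + 1), by omega⟩, rfl⟩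
    rw [← add_assoc, run_simulation_succ_of_eq (i := i) (by omega) (ih (Nat.le_of_succ_le hj)),
      ← hi, show t.depth - j = i + 1 by omega, flip_partialTranscript_succ]

theorem run_simulation_final :
    t.simulation.run x y (2 * (2 * t.depth + 1)) =
      (Function.invFun t.answer (t.eval x y), fun _ => false) := by
  rw [show 2 * t.depth + 1 = t.depth + 1 + t.depth by omega, run_simulation_depth_add le_rfl,
    Nat.sub_self, partialTranscript_zero]

theorem card_simState_lt (t : DetTree X Y Z) : Fintype.card t.SimState < 2 ^ (2 * t.depth + 1) := by
  rw [Fintype.card_prod, Fintype.card_fun, Fintype.card_bool, Fintype.card_fin, ← pow_add,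
    ← two_mul]
  exact Nat.pow_lt_pow_succ one_lt_two

theorem exists_quantum_protocol_of_simulation (t : DetTree X Y Z) {ε : ℝ} (hε : 0 < ε) :
    ∃ P : QProtocol X Y Z, P.cost = (2 * (2 * t.depth + 1) + 1) * (2 * t.depth + 1) ∧
      P.ComputesWithError t.eval ε ∧ P.RevealsOnly t.eval :=
  t.simulation.exists_quantum_protocol t.card_simState_lt (even_two_mul _)
    (mul_ne_zero two_ne_zero (Nat.succ_ne_zero _)) (out := fun s => t.answer s.1)
    (fun x y => by
      rw [run_simulation_final, Function.invFun_eq ⟨_, answer_partialTranscript le_rfl x y⟩])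
    (fun x y x' y' h => by rw [run_simulation_final, run_simulation_final, h]) hε

end Simulation

theorem exists_quantum_protocol_of_depth_eq_zero {t : DetTree X Y Z} (ht : t.depth = 0) {ε : ℝ}
    (hε : 0 ≤ ε) :
    ∃ P : QProtocol X Y Z, P.cost = 0 ∧ P.ComputesWithError t.eval ε ∧ P.RevealsOnly t.eval := by
  refine ⟨copyProtocol (k := 0) 0 (fun _ _ => 1) (fun _ _ => 1) fun _ => t.value, rfl,
    fun x y => ?_, revealsOnly_copyProtocol (fun _ _ _ _ t ht => absurd ht t.not_lt_zero)
      fun _ _ _ _ _ => rfl⟩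
  have hblank : ‖JointState.blankVec 0 fun _ => false‖ ^ 2 = 1 := by
    rw [JointState.blankVec, Pi.single_eq_same, norm_one, one_pow]
  calc 1 - ε ≤ 1 := sub_le_self _ hε
    _ = ‖JointState.blankVec 0 fun _ => false‖ ^ 2 := hblank.symm
    _ ≤ _ := norm_sq_unitaryRun_le_successProb Even.zero t.eval (eval_eq_value ht x y).symm

theorem exists_quantum_protocol (t : DetTree X Y Z) {ε : ℝ} (hε : 0 < ε) :
    ∃ P : QProtocol X Y Z, P.cost ≤ 21 * t.depth ^ 2 ∧
      P.ComputesWithError t.eval ε ∧ P.RevealsOnly t.eval := by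
  obtain ht | ht := t.depth.eq_zero_or_pos
  · obtain ⟨P, hcost, hP⟩ := exists_quantum_protocol_of_depth_eq_zero ht hε.le
    exact ⟨P, hcost.trans_le (Nat.zero_le _), hP⟩
  · obtain ⟨P, hcost, hP⟩ := t.exists_quantum_protocol_of_simulation hε
    exact ⟨P, hcost.trans_le (by nlinarith), hP⟩

end DetTree

theorem exists_detTree_of_detCC_eq {X : Type u} {Y : Type v} {Z : Type w} {f : X → Y → Z} {c : ℕ}
    (h : detCC f = c) : ∃ t : DetTree X Y Z, t.depth = c ∧ t.eval = f := by
  rw [detCC, iInf_subtype'] at h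
  obtain ⟨⟨⟨t, ht⟩, hdepth⟩, -⟩ := ENat.iInf_eq_natCast_iff.1 h
  exact ⟨t, Nat.cast_injective hdepth, funext₂ ht⟩

theorem mainTheorem10 :
    ∃ C : ℕ, ∀ (X : Type u) (Y : Type v) (Z : Type w) (f : X → Y → Z) (c : ℕ),
      detCC f = (c : ℕ∞) → ∀ ε : ℝ, 0 < ε →
        ∃ P : QProtocol X Y Z,
          P.cost ≤ C * c ^ 2 ∧
          P.ComputesWithError f ε ∧
          (∀ A : QPlayer X P.width, P.HonestAl A →
            ∃ σ : X → Z → Matrix (QubitBasis A.mem) (QubitBasis A.mem) ℂ,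
              (∀ x z, IsDensityMatrix (σ x z)) ∧
              ∀ x y, traceNorm (P.finalAl A x y - σ x (f x y)) ≤ ε) ∧
          (∀ B : QPlayer Y P.width, P.HonestBob B →
            ∃ σ : Y → Z → Matrix (QubitBasis B.mem) (QubitBasis B.mem) ℂ,
              (∀ y z, IsDensityMatrix (σ y z)) ∧
              ∀ x y, traceNorm (P.finalBob B x y - σ y (f x y)) ≤ ε) := by
  refine ⟨21, fun X Y Z f c hc ε hε => ?_⟩
  obtain ⟨t, rfl, rfl⟩ := exists_detTree_of_detCC_eq hc
  obtain ⟨P, hcost, herror, hAl, hBob⟩ := t.exists_quantum_protocol hε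
  refine ⟨P, hcost, herror, fun A hA => ?_, fun B hB => ?_⟩
  · exact exists_isDensityMatrix_traceNorm_sub_le (P.isDensityMatrix_finalAl A) (hAl A hA) hε.le
  · obtain ⟨σ, hσ, hle⟩ := exists_isDensityMatrix_traceNorm_sub_le
      (fun y x => P.isDensityMatrix_finalBob B x y) (hBob B hB) hε.le
    exact ⟨σ, hσ, fun x y => hle y x⟩
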